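/- Let $q_1,q_2,q_3,q_4$ be distinct primes. **(1) The primes.** There are primes $r_1,\dots,r_4$, $s_1,\dots,s_4$ such that $q_1,\dots,q_4,r_1,\dots,r_4,s_1,\dots,s_4$ are twelve distinct primes and $$q_1\mid r_1-1,\quad q_2\mid r_2-1,\quad q_1q_2q_3\mid r_3-1,\quad q_2q_4\mid r_4-1,\quad q_1q_2q_3q_4r_1r_2r_3r_4\mid s_i-1\ (1\le i\le 4).$$ Now fix any such $r_i,s_i$. Let $Q_i$ and $R_i$ be cyclic of orders $q_i$ and $r_i$, and put $Q=Q_1\times Q_2\times Q_3\times Q_4$ and $R=R_1\times R_2\times R_3\times R_4$. A group acts *fixed point freely* on a group or module if no non-identity element of it fixes a non-trivial element. **(2) The action of $Q$ on $R$.** There is an action of $Q$ on $R$ by automorphisms, normalizing every $R_j$, such that $Q_1$ acts fixed point freely on $R_1,R_3$; $Q_2$ on $R_2,R_3,R_4$; $Q_3$ on $R_3$; $Q_4$ on $R_4$; and each $Q_i$ acts trivially on the other $R_j$. Fix any such action and let $RQ=R\rtimes Q$. Put $B_1=\{1\}$, $B_2=\{2\}$, $B_3=\{1,2,3\}$, $B_4=\{1,2,4\}$,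 and for each $i$ let $H_i=\prod_{j\in B_i}R_j\cdot\prod_{j\in B_i}Q_j\le RQ$. **(3) The modules.** For $i=1,\dots,4$ there is a finite-dimensional $GF(s_i)RQ$-module $V_i$ such that * $V_i$ is faithful and irreducible as an $H_i$-module, and $\prod_{j\in B_i}R_j$ acts fixed point freely on $V_i$; * $R_j$ acts trivially on $V_i$ for each $j\notin B_i$; * $Q_j$ acts on $V_i$ by scalars from $GF(s_i)$ and fixed point freely, for each $j\notin B_i$. **(4) The conclusion.** For every choice of such modules, the semidirect product $G=(V_1\times V_2\times V_3\times V_4)\rtimes RQ$ is a finite solvable group, $|G|$ has exactly $12$ distinct prime divisors, and $\sigma^c(G)=4$. Here $\sigma^c(G)$ is the largest integer $m$ such that some codegree $\mathrm{cod}(\chi)=|G:\ker\chi|/\chi(1)$, with $\chi$ an irreducible complex character of $G$, has exactly $m$ distinct prime divisors. -/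

import Mathlib

/-! ### Codegrees -/

/-- The codegree `cod(χ) = |G : ker χ| / χ(1)` of the character `χ` afforded by `ρ`
(the kernel of `χ` is the kernel of `ρ`). -/
noncomputable def codegree {G : Type*} [Group G] {V : Type*} [AddCommGroup V] [Module ℂ V]
    (ρ : Representation ℂ G V) : ℂ :=
  ((MonoidHom.ker ρ).index : ℂ) / ρ.character 1

/-- `cod(G)`: the set of codegrees of the irreducible complex characters of `G`. Codegrees of a
finite group are positive integers, so they are recorded as natural numbers. -/
def codSet (G : Type*) [Group G] : Set ℕ :=
  {n | ∃ (V : Type) (_ : AddCommGroup V) (_ : Module ℂ V) (_ : FiniteDimensional ℂ V)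
    (ρ : Representation ℂ G V), ρ.IsIrreducible ∧ codegree ρ = (n : ℂ)}

/-- `σ^c(G) = m`: the integer `m` is the maximal number of distinct prime divisors of a
member of `cod(G)`. -/
def SigmaCEq (G : Type*) [Group G] (m : ℕ) : Prop :=
  IsGreatest {k | ∃ n ∈ codSet G, n.primeFactors.card = k} m

/-! ### Products of automorphism actions -/

/-- Actions of `H` on the groups `N j` by automorphisms give the componentwise action on their
product. -/
def piAut {H ι : Type*} [Group H] {N : ι → Type*} [∀ j, Group (N j)]
    (f : ∀ j, H →* MulAut (N j)) : H →* MulAut (∀ j, N j) where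
  toFun h := MulEquiv.piCongrRight fun j => f j h
  map_one' := by ext x j; simp
  map_mul' a b := by ext x j; simp

/-- A representation of `H` on `V`, as an action by automorphisms on `V` written
multiplicatively. -/
def repAut {k H V : Type*} [CommRing k] [Group H] [AddCommGroup V] [Module k V]
    (ρ : Representation k H V) : H →* MulAut (Multiplicative V) where
  toFun h :=
    { toFun := fun v => Multiplicative.ofAdd (ρ h v.toAdd)
      invFun := fun v => Multiplicative.ofAdd (ρ h⁻¹ v.toAdd)
      left_inv := fun v => by simp
      right_inv := fun v => by simp
      map_mul' := fun v w => by simp }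
  map_one' := by ext v; simp
  map_mul' a b := by ext v; simp

/-! ### The group of the example

All indices are shifted by one: the primes `q₁, …, q₄` are `q 0, …, q 3`, and so on. -/

namespace CodegreeExample

/-- The twelve primes: mutually distinct, with the prescribed divisibilities. -/
structure Admissible (q r s : Fin 4 → ℕ) : Prop where
  prime_q : ∀ i, (q i).Prime
  prime_r : ∀ i, (r i).Prime
  prime_s : ∀ i, (s i).Prime
  injective_q : Function.Injective q
  injective_r : Function.Injective r
  injective_s : Function.Injective s
  q_ne_r : ∀ i j, q i ≠ r j
  q_ne_s : ∀ i j, q i ≠ s j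
  r_ne_s : ∀ i j, r i ≠ s j
  dvd_r0 : q 0 ∣ r 0 - 1
  dvd_r1 : q 1 ∣ r 1 - 1
  dvd_r2 : q 0 * q 1 * q 2 ∣ r 2 - 1
  dvd_r3 : q 1 * q 3 ∣ r 3 - 1
  dvd_s : ∀ i, (∏ j, q j) * (∏ j, r j) ∣ s i - 1

/-- The direct product of cyclic groups of orders `n 0, …, n 3`. -/
abbrev CycProd (n : Fin 4 → ℕ) : Type := ∀ i, Multiplicative (ZMod (n i))

/-- The set of those `j` for which `Q_i` acts nontrivially on `R_j`. -/
def actsOn : Fin 4 → Finset (Fin 4) := ![{0, 2}, {1, 2, 3}, {2}, {3}]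

/-- An action of `Q = Q₀ × Q₁ × Q₂ × Q₃` on `R₀, R₁, R₂, R₃` in which `Q_i` acts fixed point
freely on `R_j` for `j ∈ actsOn i` and trivially otherwise. -/
structure QRAction (q r : Fin 4 → ℕ) where
  act : ∀ j, CycProd q →* MulAut (Multiplicative (ZMod (r j)))
  fixedPointFree : ∀ i, ∀ j ∈ actsOn i, ∀ t : Multiplicative (ZMod (q i)), t ≠ 1 →
    ∀ x, act j (Pi.mulSingle i t) x = x → x = 1
  trivial : ∀ i, ∀ j ∉ actsOn i, ∀ (t : Multiplicative (ZMod (q i))) (x),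
    act j (Pi.mulSingle i t) x = x

variable {q r : Fin 4 → ℕ}

/-- The semidirect product `RQ` of `R = R₀ × R₁ × R₂ × R₃` by `Q`. -/
abbrev QRAction.RQ (A : QRAction q r) : Type := CycProd r ⋊[piAut A.act] CycProd q

/-- The indices `j` such that `Q_j` and `R_j` occur in the group of which `V_i` is a faithful
irreducible module. -/
def block : Fin 4 → Finset (Fin 4) := ![{0}, {1}, {0, 1, 2}, {0, 1, 3}]

/-- The subgroup `∏_{j ∈ block i} Q_j · ∏_{j ∈ block i} R_j` of `RQ`. -/
def QRAction.blockSubgroup (A : QRAction q r) (i : Fin 4) : Subgroup A.RQ where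
  carrier := {g | ∀ j ∉ block i, g.left j = 1 ∧ g.right j = 1}
  one_mem' := fun j _ => by simp
  mul_mem' := fun {a b} ha hb j hj => by simp [piAut, ha j hj, hb j hj]
  inv_mem' := fun {a} ha j hj => by simp [piAut, ha j hj]

/-- Modules `V_0, …, V_3` for `RQ`, where `V_i` is over the field with `s i` elements, as in the
example. -/
structure Modules (A : QRAction q r) (s : Fin 4 → ℕ) [∀ i, Fact (s i).Prime] where
  V : Fin 4 → Type
  [addCommGroup : ∀ i, AddCommGroup (V i)]
  [module : ∀ i, Module (ZMod (s i)) (V i)]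
  [finiteDimensional : ∀ i, FiniteDimensional (ZMod (s i)) (V i)]
  ρ : ∀ i, Representation (ZMod (s i)) A.RQ (V i)
  /-- `V_i` is irreducible for the block subgroup. -/
  irreducible : ∀ i, Representation.IsIrreducible (k := ZMod (s i)) (V := V i)
    ((ρ i).comp (A.blockSubgroup i).subtype)
  /-- `V_i` is faithful for the block subgroup. -/
  faithful : ∀ i, ∀ g ∈ A.blockSubgroup i, ρ i g = 1 → g = 1
  /-- `∏_{j ∈ block i} R_j` acts fixed point freely on `V_i`. -/
  fixedPointFree_R : ∀ i, ∀ x : CycProd r, (∀ j ∉ block i, x j = 1) → x ≠ 1 →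
    ∀ v, ρ i (SemidirectProduct.inl x) v = v → v = 0
  /-- The remaining `R_j` act trivially on `V_i`. -/
  trivial_R : ∀ i, ∀ j ∉ block i, ∀ (x : Multiplicative (ZMod (r j))) (v),
    ρ i (SemidirectProduct.inl (Pi.mulSingle j x)) v = v
  /-- The remaining `Q_j` act on `V_i` by scalars. -/
  scalar_Q : ∀ i, ∀ j ∉ block i, ∀ t : Multiplicative (ZMod (q j)), ∃ c : ZMod (s i), ∀ v,
    ρ i (SemidirectProduct.inr (Pi.mulSingle j t)) v = c • v
  /-- The remaining `Q_j` act fixed point freely on `V_i`. -/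
  fixedPointFree_Q : ∀ i, ∀ j ∉ block i, ∀ t : Multiplicative (ZMod (q j)), t ≠ 1 →
    ∀ v, ρ i (SemidirectProduct.inr (Pi.mulSingle j t)) v = v → v = 0

attribute [instance] Modules.addCommGroup Modules.module Modules.finiteDimensional

/-- The group `G`: the semidirect product of `V₀ × V₁ × V₂ × V₃` by `RQ`. -/
abbrev Modules.G {A : QRAction q r} {s : Fin 4 → ℕ} [∀ i, Fact (s i).Prime]
    (M : Modules A s) : Type :=
  (∀ i, Multiplicative (M.V i)) ⋊[piAut fun i => repAut (M.ρ i)] A.RQ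

end CodegreeExample

/-! Lower bound: `∏ j, q j` is the codegree of a faithful linear character of the cyclic group Q,
inflated to G.

Upper bound: let ρ be irreducible with codegree n, so that |ker ρ| · n · deg ρ = |G|. The primes q_j
and r_k divide |G| exactly once, so those dividing n cannot divide deg ρ. The s_i-part of |G| is
|V_i|, so s_i ∣ n forces V_i out of the kernel; likewise r_k ∣ n forces R_k out of it. The main tool
is `IsIrreducible.card_dvd_finrank`: if P acts fixed point freely on a subgroup N whose image under
ρ is normal and non-trivial, then the character vanishes on P away from 1, so |P| divides deg ρ.
This restricts which primes can divide n together: - s_i and r_k only if k ∉ `block i` (R_k acting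
on V_i); - s_i and q_j only if j ∈ `block i` (Q_j acting on V_i); - r_k and q_j only if k ∉ `actsOn
j` (Q_j acting on R_k). For the last, R_k need not be normal in G, but it is modulo ker ρ, because
r_k ∣ n puts every V_i with k ∈ `block i` in the kernel. By `card_add_card_add_card_le_four`, no
five of the twelve primes are pairwise compatible.

Existence: Dirichlet's theorem supplies the primes, Q acts on each R_j through units of `ZMod (r
j)`, and V_i is a monomial module on the Q-orbit of a linear character of R. -/

open Module

/-! ### Fixed point free action and character degrees -/

namespace Representation

variable {G W : Type*} [Group G] [AddCommGroup W] [Module ℂ W]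

/-- If `N` maps to a subgroup of `G` whose image under the irreducible representation `ρ` is
normal and non-trivial, then the elements of `N` sum to zero on the representation. -/
theorem IsIrreducible.sum_eq_zero_of_conj_mem {ρ : Representation ℂ G W} (hρ : ρ.IsIrreducible)
    {N : Type*} [Group N] [Fintype N] (φ : N →* G)
    (hconj : ∀ g n, ∃ n', ρ (g⁻¹ * φ n * g) = ρ (φ n')) (hne : ∃ n, ρ (φ n) ≠ 1) :
    ∑ n, ρ (φ n) = 0 := by
  -- The vectors fixed by N form a G-subrepresentation, which is zero as N acts non-trivially. The
  -- sum over N has its image there.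
  let U : Subrepresentation ρ :=
    { toSubmodule := invariants (ρ.comp φ)
      apply_mem_toSubmodule := fun g v hv n => by
        obtain ⟨n', hn'⟩ := hconj g n
        have h : ρ (φ n) * ρ g = ρ g * ρ (g⁻¹ * φ n * g) := by
          rw [← map_mul, ← map_mul]; congr 1; group
        have h2 := congrArg (fun f => f v) h
        simp only [Module.End.mul_apply, hn'] at h2
        have h3 : ρ (φ n') v = v := hv n'
        rw [h3] at h2
        exact h2 }
  have hU : U = ⊥ := by
    rcases eq_bot_or_eq_top U with h | h
    · exact h
    · exfalso
      obtain ⟨n, hn⟩ := hne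
      apply hn
      ext v
      have hv : v ∈ U := by rw [h]; trivial
      exact hv n
  ext v
  have hmem : (∑ n, ρ (φ n)) v ∈ U := by
    intro m
    change ρ (φ m) _ = _
    rw [← Module.End.mul_apply, Finset.mul_sum]
    congr 1
    simp_rw [← map_mul]
    exact Fintype.sum_equiv (Equiv.mulLeft m) _ _ fun _ => rfl
  rw [hU] at hmem
  exact hmem

/-- A finite group acting fixed point freely on a section of `G` that an irreducible
representation does not kill has order dividing the dimension of the representation. -/
theorem IsIrreducible.card_dvd_finrank [FiniteDimensional ℂ W] {ρ : Representation ℂ G W} (hρ : ρ.IsIrreducible)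
    {N P : Type*} [Group N] [Finite N] [Group P] [Finite P] (φ : N →* G) (ψ : P →* G)
    (α : P →* MulAut N) (hα : ∀ t n, ψ t * φ n * (ψ t)⁻¹ = φ (α t n))
    (hfpf : ∀ t ≠ 1, ∀ n, α t n = n → n = 1)
    (hconj : ∀ g n, ∃ n', ρ (g⁻¹ * φ n * g) = ρ (φ n')) (hne : ∃ n, ρ (φ n) ≠ 1) :
    Nat.card P ∣ finrank ℂ W := by
  have := Fintype.ofFinite N
  have := Fintype.ofFinite P
  have hsum := hρ.sum_eq_zero_of_conj_mem φ hconj hne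
  have hchar : ∀ t ≠ 1, ρ.character (ψ t) = 0 := by
    intro t ht
    -- Fixed point freeness makes this commutator map a permutation of N, so the N-conjugates of `ψ
    -- t` run over the whole coset N · `ψ t`. They all have the same trace, and their sum is zero.
    have hinj : Function.Injective fun n : N => n * (α t n)⁻¹ := by
      intro a b hab
      have : α t (b⁻¹ * a) = b⁻¹ * a := by
        rw [mul_inv_eq_iff_eq_mul, mul_assoc, ← inv_mul_eq_iff_eq_mul] at hab
        rw [map_mul, map_inv, hab]
      have := hfpf t ht _ this
      rw [inv_mul_eq_one] at this
      exact this.symm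
    have hbij := Finite.injective_iff_bijective.mp hinj
    have h1 : ∑ n, ρ (φ n * ψ t * (φ n)⁻¹) = 0 := by
      calc ∑ n, ρ (φ n * ψ t * (φ n)⁻¹) = ∑ n, ρ (φ (n * (α t n)⁻¹)) * ρ (ψ t) := by
            refine Finset.sum_congr rfl fun n _ => ?_
            rw [← map_mul, map_mul φ, map_inv φ, ← hα]
            congr 1
            group
        _ = (∑ n, ρ (φ n)) * ρ (ψ t) := by
            rw [← Finset.sum_mul]
            congr 1
            exact Fintype.sum_bijective _ hbij _ _ fun _ => rfl
        _ = 0 := by rw [hsum, zero_mul]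
    have h2 := congrArg (LinearMap.trace ℂ W) h1
    rw [map_sum, map_zero] at h2
    have h3 : ∀ n, LinearMap.trace ℂ W (ρ (φ n * ψ t * (φ n)⁻¹)) = ρ.character (ψ t) :=
      fun n => char_conj ρ _ _
    simp_rw [h3] at h2
    simpa using h2
  have hinv : Invertible (Nat.card P : ℂ) := invertibleOfNonzero (by
    exact_mod_cast Nat.card_pos.ne')
  -- Only the identity contributes to the average of the character over P, so dim W = |P| · dim W^P.
  have h := card_inv_mul_sum_char_eq_finrank (ρ.comp ψ)
  have h1 : ∑ t, Representation.character (ρ.comp ψ) t = finrank ℂ W :=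
    (Fintype.sum_eq_single (1 : P) hchar).trans (char_one (ρ.comp ψ))
  rw [h1, inv_mul_eq_iff_eq_mul₀ (by exact_mod_cast Nat.card_pos.ne')] at h
  exact ⟨_, by exact_mod_cast h⟩

end Representation

/-! ### Prime powers in products -/

section Arithmetic

/-- Distinct primes cannot occur to a higher power than prescribed in a product of powers. -/
theorem Nat.not_mul_pow_dvd_prod_pow {ι : Type*} [Fintype ι] [DecidableEq ι] {p : ι → ℕ}
    (hp : ∀ k, (p k).Prime) (hinj : Function.Injective p) (e : ι → ℕ) (k : ι) :
    ¬ p k * p k ^ e k ∣ ∏ i, p i ^ e i := by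
  intro h
  rw [← Finset.mul_prod_erase _ _ (Finset.mem_univ k), mul_comm] at h
  have h1 := Nat.dvd_of_mul_dvd_mul_left (pow_pos (hp k).pos _) h
  obtain ⟨i, hi, hd⟩ := (Prime.dvd_finsetProd_iff (hp k).prime _).mp h1
  have h2 := (Nat.prime_dvd_prime_iff_eq (hp k) (hp i)).mp ((hp k).dvd_of_dvd_pow hd)
  exact (Finset.ne_of_mem_erase hi) (hinj h2).symm

theorem Nat.primeFactors_prod_pow_eq_image {ι : Type*} [Fintype ι] {p : ι → ℕ}
    (hp : ∀ k, (p k).Prime) {e : ι → ℕ} (he : ∀ k, e k ≠ 0) :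
    (∏ i, p i ^ e i).primeFactors = Finset.univ.image p := by
  ext l
  rw [Nat.mem_primeFactors, Finset.mem_image]
  constructor
  · rintro ⟨hl, hd, -⟩
    obtain ⟨i, hi, hd⟩ := (Prime.dvd_finsetProd_iff hl.prime _).mp hd
    exact ⟨i, hi, ((Nat.prime_dvd_prime_iff_eq hl (hp i)).mp (hl.dvd_of_dvd_pow hd)).symm⟩
  · rintro ⟨i, hi, rfl⟩
    exact ⟨hp i, (dvd_pow_self _ (he i)).trans (Finset.dvd_prod_of_mem _ hi),
      Finset.prod_ne_zero_iff.mpr fun j _ => pow_ne_zero _ (hp j).ne_zero⟩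

theorem Fin.dvd_of_prod_dvd {n : Fin 4 → ℕ} {j : Fin 4} {m : ℕ} (h : ∏ j, n j ∣ m) : n j ∣ m :=
  (Finset.dvd_prod_of_mem n (Finset.mem_univ j)).trans h

end Arithmetic

/-! ### Faithful characters of cyclic groups and their products -/

section Homs

/-- A primitive `n`-th root of unity gives a faithful character of the cyclic group of order `n`. -/
theorem IsPrimitiveRoot.exists_injective_hom {R : Type*} [CommRing R] {ζ : Rˣ} {n : ℕ}
    (h : IsPrimitiveRoot ζ n) :
    ∃ f : Multiplicative (ZMod n) →* Rˣ, Function.Injective f := by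
  let e : Multiplicative (ZMod n) ≃* Subgroup.zpowers ζ :=
    h.zmodEquivZPowers.symm.toMultiplicativeRight.symm
  exact ⟨(Subgroup.zpowers ζ).subtype.comp e.toMonoidHom,
    Subtype.val_injective.comp e.injective⟩

theorem ZMod.exists_injective_hom_units {p n : ℕ} [Fact p.Prime] (h : n ∣ p - 1) :
    ∃ f : Multiplicative (ZMod n) →* (ZMod p)ˣ, Function.Injective f := by
  obtain ⟨g, hg⟩ := IsCyclic.exists_generator (α := (ZMod p)ˣ)
  have ho : orderOf g = p - 1 := by
    rw [orderOf_eq_card_of_forall_mem_zpowers hg, Nat.card_eq_fintype_card, ZMod.card_units]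
  have hpos : 0 < p - 1 := Nat.sub_pos_of_lt (Fact.out : p.Prime).one_lt
  obtain ⟨m, hm⟩ := h
  have := IsPrimitiveRoot.orderOf g
  rw [ho] at this
  exact (this.pow (a := m) (b := n) hpos (by rw [hm, mul_comm])).exists_injective_hom

theorem Complex.exists_injective_hom_units {n : ℕ} (hn : n ≠ 0) :
    ∃ f : Multiplicative (ZMod n) →* ℂˣ, Function.Injective f :=
  ((Complex.isPrimitiveRoot_exp n hn).isUnit_unit' hn).exists_injective_hom

namespace CodegreeExample

variable {n : Fin 4 → ℕ}

/-- The product of characters of the factors of `CycProd n`. -/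
def prodHom {M : Type*} [CommGroup M] (f : ∀ j, Multiplicative (ZMod (n j)) →* M) :
    CycProd n →* M :=
  ∏ j, (f j).comp (Pi.evalMonoidHom _ j)

theorem prodHom_apply {M : Type*} [CommGroup M] (f : ∀ j, Multiplicative (ZMod (n j)) →* M)
    (x : CycProd n) : prodHom f x = ∏ j, f j (x j) := by
  simp [prodHom, MonoidHom.finsetProd_apply]

theorem prodHom_mulSingle {M : Type*} [CommGroup M] (f : ∀ j, Multiplicative (ZMod (n j)) →* M)
    (j : Fin 4) (x : Multiplicative (ZMod (n j))) : prodHom f (Pi.mulSingle j x) = f j x := by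
  rw [prodHom_apply, Finset.prod_eq_single j]
  · simp
  · intro k _ hk
    rw [Pi.mulSingle_eq_of_ne hk, map_one]
  · simp

theorem pow_eq_one_of_cyc {m : ℕ} (x : Multiplicative (ZMod m)) : x ^ m = 1 := by
  apply Multiplicative.toAdd.injective
  simp

/-- If the orders of the factors are pairwise coprime, a homomorphism that kills an element kills
its components. -/
theorem map_mulSingle_eq_one {M : Type*} [Group M] (hn : Pairwise (Function.onFun Nat.Coprime n))
    (f : CycProd n →* M) {x : CycProd n} (hx : f x = 1) (j : Fin 4) :
    f (Pi.mulSingle j (x j)) = 1 := by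
  -- This exponent kills every component except the j-th, on which it is coprime to the order.
  have h1 : x ^ (∏ k ∈ Finset.univ.erase j, n k) =
      Pi.mulSingle j (x j) ^ (∏ k ∈ Finset.univ.erase j, n k) := by
    ext k
    by_cases hk : k = j
    · subst hk; simp
    · obtain ⟨c, hc⟩ := Finset.dvd_prod_of_mem n (Finset.mem_erase.mpr ⟨hk, Finset.mem_univ k⟩)
      rw [Pi.pow_apply, Pi.pow_apply, Pi.mulSingle_eq_of_ne hk, one_pow, hc, pow_mul,
        pow_eq_one_of_cyc, one_pow]
  have h2 : f (Pi.mulSingle j (x j)) ^ (∏ k ∈ Finset.univ.erase j, n k) = 1 := by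
    rw [← map_pow, ← h1, map_pow, hx, one_pow]
  have h3 : f (Pi.mulSingle j (x j)) ^ n j = 1 := by
    rw [← map_pow, ← Pi.mulSingle_pow, pow_eq_one_of_cyc, Pi.mulSingle_one, map_one]
  have hc : Nat.Coprime (∏ k ∈ Finset.univ.erase j, n k) (n j) :=
    Nat.Coprime.prod_left fun k hk => hn (Finset.ne_of_mem_erase hk)
  rw [← orderOf_dvd_iff_pow_eq_one] at h2 h3
  exact orderOf_eq_one_iff.mp (Nat.eq_one_of_dvd_coprimes hc h2 h3)

end CodegreeExample

end Homs

/-! ### The combinatorial bound and the choice of primes -/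

namespace CodegreeExample

/-- Here `S`, `a`, `b` stand for the indices of the s_i, r_k, q_j dividing a codegree. Primes of the
same kind are always compatible, so 4 is attained; the tables `block` and `actsOn` are arranged to
exclude 5, by inspection of the 2^12 triples. -/
theorem card_add_card_add_card_le_four : ∀ S a b : Finset (Fin 4),
    (∀ i ∈ S, ∀ j ∈ a, j ∉ block i) → (∀ i ∈ S, ∀ j ∈ b, j ∈ block i) →
    (∀ j ∈ b, ∀ k ∈ a, k ∉ actsOn j) → S.card + (a.card + b.card) ≤ 4 := by
  decide +kernel

theorem exists_admissible (q : Fin 4 → ℕ) (hq : ∀ i, (q i).Prime) (hinj : Function.Injective q) :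
    ∃ r s : Fin 4 → ℕ, Admissible q r s := by
  have key : ∀ (m : ℕ), m ≠ 0 → ∀ b, ∃ p, p.Prime ∧ b < p ∧ m ∣ p - 1 := by
    intro m hm b
    obtain ⟨p, hp, hb, hmod⟩ := Nat.exists_prime_gt_modEq_one b hm
    exact ⟨p, hp, hb, (Nat.modEq_iff_dvd' hp.one_lt.le).mp hmod.symm⟩
  have h0 : ∏ j, q j ≠ 0 := Finset.prod_ne_zero_iff.mpr fun j _ => (hq j).ne_zero
  have hle : ∀ j, q j ≤ ∏ j, q j := fun j =>
    Nat.le_of_dvd (Nat.pos_of_ne_zero h0) (Finset.dvd_prod_of_mem q (Finset.mem_univ j))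
  -- Every r_j is taken congruent to 1 modulo all the q_i, which is more than required, and each new
  -- prime exceeds the previous ones, which gives distinctness.
  obtain ⟨r0, pr0, lr0, dr0⟩ := key (∏ j, q j) h0 (∏ j, q j)
  obtain ⟨r1, pr1, lr1, dr1⟩ := key (∏ j, q j) h0 r0
  obtain ⟨r2, pr2, lr2, dr2⟩ := key (∏ j, q j) h0 r1
  obtain ⟨r3, pr3, lr3, dr3⟩ := key (∏ j, q j) h0 r2
  have h1 : (∏ j, q j) * ∏ j, ![r0, r1, r2, r3] j ≠ 0 := by
    simp [Fin.prod_univ_four, pr0.ne_zero, pr1.ne_zero, pr2.ne_zero, pr3.ne_zero,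
      (hq _).ne_zero]
  obtain ⟨s0, ps0, ls0, ds0⟩ := key _ h1 r3
  obtain ⟨s1, ps1, ls1, ds1⟩ := key _ h1 s0
  obtain ⟨s2, ps2, ls2, ds2⟩ := key _ h1 s1
  obtain ⟨s3, ps3, ls3, ds3⟩ := key _ h1 s2
  have hr : StrictMono ![r0, r1, r2, r3] := by
    rw [Fin.strictMono_iff_lt_succ]
    intro i; fin_cases i <;> simpa
  have hs : StrictMono ![s0, s1, s2, s3] := by
    rw [Fin.strictMono_iff_lt_succ]
    intro i; fin_cases i <;> simpa
  have hqr : ∀ i, q i < r0 := fun i => (hle i).trans_lt lr0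
  have hr0 : ∀ j, r0 ≤ ![r0, r1, r2, r3] j := fun j => hr.monotone (Fin.zero_le j)
  have hr3 : ∀ j, ![r0, r1, r2, r3] j ≤ r3 := fun j => hr.monotone (Fin.le_last j)
  have hs0 : ∀ j, s0 ≤ ![s0, s1, s2, s3] j := fun j => hs.monotone (Fin.zero_le j)
  have hrs : r0 ≤ r3 := hr0 3
  refine ⟨![r0, r1, r2, r3], ![s0, s1, s2, s3], ?_⟩
  refine
    { prime_q := hq
      prime_r := fun i => by fin_cases i <;> simpa
      prime_s := fun i => by fin_cases i <;> simpa
      injective_q := hinj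
      injective_r := hr.injective
      injective_s := hs.injective
      q_ne_r := fun i j => ((hqr i).trans_le (hr0 j)).ne
      q_ne_s := fun i j => by have := hqr i; have := hs0 j; omega
      r_ne_s := fun i j => by have := hr3 i; have := hs0 j; omega
      dvd_r0 := Fin.dvd_of_prod_dvd dr0
      dvd_r1 := Fin.dvd_of_prod_dvd dr1
      dvd_r2 := (Dvd.intro (q 3) (by rw [Fin.prod_univ_four])).trans dr2
      dvd_r3 := (Dvd.intro (q 0 * q 2) (by rw [Fin.prod_univ_four]; ring)).trans dr3
      dvd_s := fun i => by fin_cases i <;> simpa }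

end CodegreeExample

/-! ### Monomial representations on orbits of linear characters -/

section MonomialRepresentations

variable {N H : Type*} [Group N] [Group H]

/-- The linear characters of `N`, on which `H` acts through its action `φ` on `N`. -/
def CharSpace (_φ : H →* MulAut N) (F : Type*) [Field F] : Type _ := N →* Fˣ

variable {φ : H →* MulAut N} {F : Type*} [Field F]

/-- The underlying homomorphism of a linear character. -/
def CharSpace.hom (u : CharSpace φ F) : N →* Fˣ := u

theorem CharSpace.ext {u v : CharSpace φ F} (h : ∀ n, u.hom n = v.hom n) : u = v :=
  MonoidHom.ext h

instance : MulAction H (CharSpace φ F) where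
  smul h u := u.hom.comp (φ h⁻¹).toMonoidHom
  one_smul u := CharSpace.ext fun n => by
    change u.hom (φ 1⁻¹ n) = _
    simp
  mul_smul a b u := CharSpace.ext fun n => by
    change u.hom (φ (a * b)⁻¹ n) = u.hom (φ b⁻¹ (φ a⁻¹ n))
    simp

theorem CharSpace.smul_hom_apply (h : H) (u : CharSpace φ F) (n : N) :
    (h • u).hom n = u.hom (φ h⁻¹ n) := rfl

/-- The representation of `N ⋊ H` on the functions on an orbit of linear characters of `N`, twisted
by a linear character of `H`. It is induced from an extension of a point of the orbit. -/
def orbitRep (l : CharSpace φ F) (μ : H →* Fˣ) :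
    Representation F (N ⋊[φ] H) (MulAction.orbit H l → F) where
  toFun g :=
    { toFun := fun f u => ((u : CharSpace φ F).hom g.left * μ g.right : Fˣ) * f (g.right⁻¹ • u)
      map_add' := fun f f' => by ext u; simp [mul_add]
      map_smul' := fun a f => by ext u; simp [mul_left_comm] }
  map_one' := by ext f u; simp
  map_mul' g g' := by
    ext f u
    simp [CharSpace.smul_hom_apply, MulAction.orbit.coe_smul, mul_smul]
    ring

theorem orbitRep_apply (l : CharSpace φ F) (μ : H →* Fˣ) (g : N ⋊[φ] H)
    (f : MulAction.orbit H l → F) (u : MulAction.orbit H l) :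
    orbitRep l μ g f u =
      ((u : CharSpace φ F).hom g.left * μ g.right : Fˣ) * f (g.right⁻¹ • u) := rfl

/-- A subgroup that separates the points of the orbit and is transitive on it acts irreducibly. -/
theorem orbitRep_isIrreducible (l : CharSpace φ F) (μ : H →* Fˣ) [Finite (MulAction.orbit H l)]
    (K : Subgroup (N ⋊[φ] H))
    (hsep : ∀ u v : MulAction.orbit H l, u ≠ v →
      ∃ n, SemidirectProduct.inl n ∈ K ∧ (u : CharSpace φ F).hom n ≠ (v : CharSpace φ F).hom n)
    (htrans : ∀ u v : MulAction.orbit H l, ∃ h, SemidirectProduct.inr h ∈ K ∧ h • u = v) :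
    Representation.IsIrreducible (k := F) (V := MulAction.orbit H l → F)
      ((orbitRep l μ).comp K.subtype) := by
  classical
  have := Fintype.ofFinite (MulAction.orbit H l)
  set σ : Representation F K (MulAction.orbit H l → F) := (orbitRep l μ).comp K.subtype
  have key : ∀ U : Subrepresentation σ, ∀ f ∈ U, f ≠ 0 → U = ⊤ := by
    intro U f hf hf0
    obtain ⟨u₀, hu₀⟩ := Function.ne_iff.mp hf0
    -- Points are removed from the support one at a time: if n separates u₀ from v, then applying n
    -- − v(n) kills the value at v but not the one at u₀. This ends at a multiple of the delta
    -- function at u₀, and transitivity yields the others.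
    have hloc : ∀ T : Finset (MulAction.orbit H l), u₀ ∉ T →
        ∃ f' ∈ U.toSubmodule, f' u₀ ≠ 0 ∧ ∀ v ∈ T, f' v = 0 := by
      intro T
      induction T using Finset.induction_on with
      | empty => exact fun _ => ⟨f, hf, hu₀, by simp⟩
      | insert v T _ ih =>
        intro hT
        rw [Finset.mem_insert, not_or] at hT
        obtain ⟨f', hf', hne, hz⟩ := ih hT.2
        obtain ⟨n, hn, hsepn⟩ := hsep u₀ v hT.1
        have hval : ∀ u, σ ⟨SemidirectProduct.inl n, hn⟩ f' u =
            ((u : CharSpace φ F).hom n : Fˣ) * f' u := by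
          intro u
          change orbitRep l μ (SemidirectProduct.inl n) f' u = _
          simp [orbitRep_apply]
        refine ⟨σ ⟨SemidirectProduct.inl n, hn⟩ f' - (((v : CharSpace φ F).hom n : Fˣ) : F) • f',
          U.toSubmodule.sub_mem (U.apply_mem_toSubmodule _ hf') (U.toSubmodule.smul_mem _ hf'),
          ?_, ?_⟩
        · rw [Pi.sub_apply, hval, Pi.smul_apply, smul_eq_mul, ← sub_mul]
          exact mul_ne_zero (sub_ne_zero.mpr fun h => hsepn (Units.ext h)) hne
        · intro w hw
          rw [Pi.sub_apply, hval, Pi.smul_apply, smul_eq_mul, ← sub_mul]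
          rcases Finset.mem_insert.mp hw with rfl | hw
          · rw [sub_self, zero_mul]
          · rw [hz w hw, mul_zero]
    obtain ⟨f', hf', hne, hz⟩ := hloc (Finset.univ.erase u₀) (by simp)
    have hsingle : Pi.single u₀ (1 : F) ∈ U.toSubmodule := by
      have : Pi.single u₀ (1 : F) = (f' u₀)⁻¹ • f' := by
        ext u
        by_cases hu : u = u₀
        · subst hu; simp [hne]
        · simp [hu, hz u (by simp [hu])]
      rw [this]
      exact U.toSubmodule.smul_mem _ hf'
    have hall : ∀ v, Pi.single v (1 : F) ∈ U.toSubmodule := by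
      intro v
      obtain ⟨h, hK, rfl⟩ := htrans u₀ v
      have : Pi.single (h • u₀) (1 : F) =
          ((μ h)⁻¹ : Fˣ).val • σ ⟨SemidirectProduct.inr h, hK⟩ (Pi.single u₀ 1) := by
        ext u
        change _ = ((μ h)⁻¹ : Fˣ).val • orbitRep l μ (SemidirectProduct.inr h) (Pi.single u₀ 1) u
        rw [orbitRep_apply]
        by_cases hu : u = h • u₀
        · subst hu; simp
        · have : h⁻¹ • u ≠ u₀ := fun h' => hu (by rw [← h', smul_inv_smul])
          simp [hu, this]
      rw [this]
      exact U.toSubmodule.smul_mem _ (U.apply_mem_toSubmodule _ hsingle)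
    apply Subrepresentation.toSubmodule_injective
    refine (eq_top_iff.mpr fun g _ => ?_ : U.toSubmodule = ⊤)
    rw [pi_eq_sum_univ g]
    refine U.toSubmodule.sum_mem fun v _ => U.toSubmodule.smul_mem _ ?_
    convert hall v using 1
    ext u
    simp [Pi.single_apply, eq_comm]
  have hnt : (⊥ : Subrepresentation σ) ≠ ⊤ := by
    intro h
    have h1 : (fun _ => 1 : MulAction.orbit H l → F) ∈ (⊥ : Subrepresentation σ) := by
      rw [h]; trivial
    have h2 : (fun _ => 1 : MulAction.orbit H l → F) = 0 := h1
    exact one_ne_zero (congrFun h2 ⟨l, MulAction.mem_orbit_self l⟩)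
  refine { exists_pair_ne := ⟨⊥, ⊤, hnt⟩, eq_bot_or_eq_top := fun U => ?_ }
  by_cases h : ∃ f ∈ U, f ≠ 0
  · obtain ⟨f, hf, hf0⟩ := h
    exact Or.inr (key U f hf hf0)
  · push Not at h
    left
    apply Subrepresentation.toSubmodule_injective
    exact (Submodule.eq_bot_iff _).mpr h

end MonomialRepresentations

/-- The one-dimensional representation given by a linear character. -/
def scalarRep {G k : Type*} [Group G] [Field k] (χ : G →* kˣ) : Representation k G k :=
  MonoidHom.comp (Algebra.lmul k k : k →ₐ[k] Module.End k k) ((Units.coeHom k).comp χ)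

theorem scalarRep_apply {G k : Type*} [Group G] [Field k] (χ : G →* kˣ) (g : G) (v : k) :
    scalarRep χ g v = χ g * v := rfl

/-- The componentwise action on a product restricts to the factors. -/
theorem piAut_apply_mulSingle {H ι : Type*} [Group H] [DecidableEq ι] {N : ι → Type*}
    [∀ j, Group (N j)] (f : ∀ j, H →* MulAut (N j)) (h : H) (j : ι) (x : N j) :
    piAut f h (Pi.mulSingle j x) = Pi.mulSingle j (f j h x) := by
  funext k
  change f k h _ = _
  by_cases hk : k = j
  · subst hk; rw [Pi.mulSingle_eq_same, Pi.mulSingle_eq_same]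
  · rw [Pi.mulSingle_eq_of_ne hk, Pi.mulSingle_eq_of_ne hk, map_one]

/-! ### Existence of the action and of the modules -/

namespace CodegreeExample

variable {q r s : Fin 4 → ℕ}

theorem mem_actsOn_self (j : Fin 4) : j ∈ actsOn j := by fin_cases j <;> decide

/-- This compatibility of the two tables is what lets Q_j act on V_i by scalars: for j outside the
block, Q_j centralizes the R_k in the block. -/
theorem notMem_actsOn_of_notMem_block :
    ∀ i, ∀ j ∉ block i, ∀ k ∈ block i, k ∉ actsOn j := by decide

namespace Admissible

theorem coprime_q (h : Admissible q r s) : Pairwise (Function.onFun Nat.Coprime q) :=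
  fun i j hij => (Nat.coprime_primes (h.prime_q i) (h.prime_q j)).mpr (h.injective_q.ne hij)

theorem coprime_r (h : Admissible q r s) : Pairwise (Function.onFun Nat.Coprime r) :=
  fun i j hij => (Nat.coprime_primes (h.prime_r i) (h.prime_r j)).mpr (h.injective_r.ne hij)

theorem dvd_of_mem_actsOn (h : Admissible q r s) : ∀ i, ∀ j ∈ actsOn i, q i ∣ r j - 1 := by
  have h20 : q 0 ∣ r 2 - 1 := (Dvd.intro (q 1 * q 2) (by ring)).trans h.dvd_r2
  have h21 : q 1 ∣ r 2 - 1 := (Dvd.intro (q 0 * q 2) (by ring)).trans h.dvd_r2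
  have h22 : q 2 ∣ r 2 - 1 := (Dvd.intro (q 0 * q 1) (by ring)).trans h.dvd_r2
  have h31 : q 1 ∣ r 3 - 1 := (Dvd.intro (q 3) (by ring)).trans h.dvd_r3
  have h33 : q 3 ∣ r 3 - 1 := (Dvd.intro (q 1) (by ring)).trans h.dvd_r3
  intro i j hj
  fin_cases i <;> fin_cases j <;>
    first | exact h.dvd_r0 | exact h.dvd_r1 | assumption | exact absurd hj (by decide)

theorem q_dvd_s (h : Admissible q r s) (i j : Fin 4) : q j ∣ s i - 1 :=
  Fin.dvd_of_prod_dvd ((Dvd.intro _ rfl).trans (h.dvd_s i))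

theorem r_dvd_s (h : Admissible q r s) (i j : Fin 4) : r j ∣ s i - 1 :=
  Fin.dvd_of_prod_dvd ((Dvd.intro_left _ rfl).trans (h.dvd_s i))

theorem nonempty_qrAction (h : Admissible q r s) : Nonempty (QRAction q r) := by
  have := fun j => Fact.mk (h.prime_r j)
  have hex : ∀ i j, ∃ f : Multiplicative (ZMod (q i)) →* (ZMod (r j))ˣ,
      (j ∈ actsOn i → Function.Injective f) ∧ (j ∉ actsOn i → f = 1) := by
    intro i j
    by_cases hj : j ∈ actsOn i
    · obtain ⟨f, hf⟩ := ZMod.exists_injective_hom_units (h.dvd_of_mem_actsOn i j hj)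
      exact ⟨f, fun _ => hf, fun hj' => absurd hj hj'⟩
    · exact ⟨1, fun hj' => absurd hj' hj, fun _ => rfl⟩
  choose f hinj htriv using hex
  have happ : ∀ i j (t : Multiplicative (ZMod (q i))) (x : Multiplicative (ZMod (r j))),
      repAut (scalarRep (prodHom fun i => f i j)) (Pi.mulSingle i t) x =
        Multiplicative.ofAdd ((f i j t : ZMod (r j)) * x.toAdd) := by
    intro i j t x
    change Multiplicative.ofAdd (scalarRep (prodHom fun i => f i j) _ _) = _
    rw [scalarRep_apply, prodHom_mulSingle]
  refine ⟨{ act := fun j => repAut (scalarRep (prodHom fun i => f i j)), fixedPointFree := ?_,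
            trivial := ?_ }⟩
  · intro i j hj t ht x hx
    rw [happ] at hx
    have hx' : (f i j t : ZMod (r j)) * x.toAdd = x.toAdd := congrArg Multiplicative.toAdd hx
    by_contra hx1
    have h0 : x.toAdd ≠ 0 := hx1
    have h1 : f i j t = 1 := Units.ext ((mul_eq_right₀ h0).mp hx')
    exact ht (hinj i j hj (h1.trans (map_one _).symm))
  · intro i j hj t x
    rw [happ, htriv i j hj]
    simp

end Admissible

namespace QRAction

variable (A : QRAction q r)

theorem act_apply_eq_self {B : Finset (Fin 4)} (k : Fin 4) (hk : ∀ j ∉ B, k ∉ actsOn j)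
    {h : CycProd q} (hh : ∀ j ∈ B, h j = 1) (x : Multiplicative (ZMod (r k))) :
    A.act k h x = x := by
  have hker : h ∈ (A.act k).ker := by
    rw [← Finset.univ_prod_mulSingle h]
    refine Subgroup.prod_mem _ fun j _ => ?_
    by_cases hj : j ∈ B
    · rw [hh j hj, Pi.mulSingle_one]; exact one_mem _
    · rw [MonoidHom.mem_ker]
      ext1 y
      exact A.trivial j k (hk j hj) _ y
  rw [MonoidHom.mem_ker] at hker
  rw [hker]; rfl

theorem eq_one_of_act_eq_one (had : Admissible q r s) {j k : Fin 4} (hk : k ∈ actsOn j)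
    {h : CycProd q} (hh : A.act k h = 1) : h j = 1 := by
  by_contra hne
  have h1 := map_mulSingle_eq_one had.coprime_q (A.act k) hh j
  have := Fact.mk (had.prime_r k)
  -- The component `h j` also acts trivially, so it fixes a generator of R_k, which is not the
  -- identity.
  have h2 := A.fixedPointFree j k hk (h j) hne (Multiplicative.ofAdd 1) (by rw [h1]; rfl)
  exact one_ne_zero (α := ZMod (r k)) h2

theorem piAut_mulSingle (h : CycProd q) (j : Fin 4) (x : Multiplicative (ZMod (r j))) :
    piAut A.act h (Pi.mulSingle j x) = Pi.mulSingle j (A.act j h x) :=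
  piAut_apply_mulSingle _ _ _ _

end QRAction

section BlockHoms

variable {n : Fin 4 → ℕ} {M : Type*} [CommGroup M]
  {B : Finset (Fin 4)} {e : ∀ j, Multiplicative (ZMod (n j)) →* M}

theorem prodHom_ite_congr {x y : CycProd n} (h : ∀ j ∈ B, x j = y j) :
    prodHom (fun j => if j ∈ B then e j else 1) x =
      prodHom (fun j => if j ∈ B then e j else 1) y := by
  simp only [prodHom_apply]
  refine Finset.prod_congr rfl fun j _ => ?_
  by_cases hj : j ∈ B
  · rw [h j hj]
  · simp [hj]

theorem eq_one_of_prodHom_ite_eq_one (hn : Pairwise (Function.onFun Nat.Coprime n))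
    (he : ∀ j, Function.Injective (e j)) {x : CycProd n}
    (h : prodHom (fun j => if j ∈ B then e j else 1) x = 1) : ∀ j ∈ B, x j = 1 := by
  intro j hj
  have := map_mulSingle_eq_one hn _ h j
  rw [prodHom_mulSingle, if_pos hj] at this
  exact he j (this.trans (map_one _).symm)

end BlockHoms

/-- The properties required of the module `V_i`. -/
structure IsBlockModule (A : QRAction q r) (i : Fin 4) {F : Type*} [Field F] {V : Type*}
    [AddCommGroup V] [Module F V] (ρ : Representation F A.RQ V) : Prop where
  irreducible : Representation.IsIrreducible (k := F) (V := V)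
    (ρ.comp (A.blockSubgroup i).subtype)
  faithful : ∀ g ∈ A.blockSubgroup i, ρ g = 1 → g = 1
  fixedPointFree_R : ∀ x : CycProd r, (∀ j ∉ block i, x j = 1) → x ≠ 1 →
    ∀ v, ρ (SemidirectProduct.inl x) v = v → v = 0
  trivial_R : ∀ j ∉ block i, ∀ (x : Multiplicative (ZMod (r j))) (v),
    ρ (SemidirectProduct.inl (Pi.mulSingle j x)) v = v
  scalar_Q : ∀ j ∉ block i, ∀ t : Multiplicative (ZMod (q j)), ∃ c : F, ∀ v,
    ρ (SemidirectProduct.inr (Pi.mulSingle j t)) v = c • v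
  fixedPointFree_Q : ∀ j ∉ block i, ∀ t : Multiplicative (ZMod (q j)), t ≠ 1 →
    ∀ v, ρ (SemidirectProduct.inr (Pi.mulSingle j t)) v = v → v = 0

section BlockModule

variable (A : QRAction q r) (i : Fin 4) {F : Type} [Field F]
  (e : ∀ j, Multiplicative (ZMod (r j)) →* Fˣ) (d : ∀ j, Multiplicative (ZMod (q j)) →* Fˣ)

/-- The character of `R` that is faithful on the factors in `block i` and trivial on the others. -/
def blockChar : CharSpace (piAut A.act) F := prodHom fun j => if j ∈ block i then e j else 1

/-- The character of `Q` that is faithful on the factors outside `block i` and trivial on the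
others. -/
def scalarChar : CycProd q →* Fˣ := prodHom fun j => if j ∈ (block i)ᶜ then d j else 1

theorem smul_blockChar_hom (a : CycProd q) (x : CycProd r) :
    (a • blockChar A i e).hom x =
      prodHom (fun j => if j ∈ block i then e j else 1) fun j => A.act j a⁻¹ (x j) := rfl

theorem smul_blockChar_hom_congr (a : CycProd q) {x y : CycProd r}
    (h : ∀ j ∈ block i, x j = y j) :
    (a • blockChar A i e).hom x = (a • blockChar A i e).hom y := by
  rw [smul_blockChar_hom, smul_blockChar_hom]
  exact prodHom_ite_congr fun j hj => by rw [h j hj]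

theorem smul_blockChar_eq_self {h : CycProd q} (hh : ∀ j ∈ block i, h j = 1) :
    h • blockChar A i e = blockChar A i e := by
  refine CharSpace.ext fun x => ?_
  rw [smul_blockChar_hom]
  refine prodHom_ite_congr fun j hj => ?_
  exact A.act_apply_eq_self j (fun k hk => notMem_actsOn_of_notMem_block i k hk j hj)
    (fun k hk => by rw [Pi.inv_apply, hh k hk, inv_one]) _

/-- Since Q is abelian, whatever fixes the base point fixes the whole orbit. -/
theorem smul_orbit_eq_self {h : CycProd q} (hh : ∀ j ∈ block i, h j = 1)
    (u : MulAction.orbit (CycProd q) (blockChar A i e)) : h • u = u := by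
  obtain ⟨_, a, rfl⟩ := u
  apply Subtype.ext
  change h • a • blockChar A i e = a • blockChar A i e
  rw [smul_smul, mul_comm, ← smul_smul, smul_blockChar_eq_self A i e hh]

theorem eq_one_of_smul_blockChar_eq_one (had : Admissible q r s)
    (he : ∀ j, Function.Injective (e j)) (a : CycProd q) {x : CycProd r}
    (hx : (a • blockChar A i e).hom x = 1) : ∀ j ∈ block i, x j = 1 := by
  intro j hj
  rw [smul_blockChar_hom] at hx
  have := eq_one_of_prodHom_ite_eq_one had.coprime_r he hx j hj
  exact (map_eq_one_iff _ (A.act j a⁻¹).injective).mp this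

theorem eq_one_of_smul_blockChar_eq_self (had : Admissible q r s)
    (he : ∀ j, Function.Injective (e j)) {h : CycProd q}
    (hh : h • blockChar A i e = blockChar A i e) : ∀ j ∈ block i, h j = 1 := by
  intro j hj
  have h1 : A.act j h⁻¹ = 1 := by
    ext1 y
    have h2 := congrArg (fun u => u.hom (Pi.mulSingle j y)) hh
    change (blockChar A i e).hom (piAut A.act h⁻¹ _) = prodHom _ _ at h2
    rw [A.piAut_mulSingle] at h2
    change prodHom _ _ = _ at h2
    rw [prodHom_mulSingle, prodHom_mulSingle, if_pos hj] at h2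
    exact he j h2
  rw [map_inv, inv_eq_one] at h1
  exact A.eq_one_of_act_eq_one had (mem_actsOn_self j) h1

/-- R acts diagonally through the characters in the orbit, all faithful on the block part and
trivial on the rest. The Q_j in the block permute the orbit regularly; the others fix each point and
act through the faithful scalars `d j`. -/
theorem isBlockModule_orbitRep (had : Admissible q r s) (he : ∀ j, Function.Injective (e j))
    (hd : ∀ j, Function.Injective (d j)) :
    IsBlockModule A i (orbitRep (blockChar A i e) (scalarChar i d)) := by
  classical
  have := fun j => Fact.mk (had.prime_q j)
  have : Finite (MulAction.orbit (CycProd q) (blockChar A i e)) := Set.finite_range _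
  have hscalar : ∀ j ∉ block i, ∀ (t : Multiplicative (ZMod (q j))) v,
      orbitRep (blockChar A i e) (scalarChar i d) (SemidirectProduct.inr (Pi.mulSingle j t)) v =
        (d j t : F) • v := by
    intro j hj t v
    ext u
    rw [orbitRep_apply, SemidirectProduct.right_inr, SemidirectProduct.left_inr, map_one, one_mul,
      smul_orbit_eq_self, scalarChar, prodHom_mulSingle, if_pos (Finset.mem_compl.mpr hj)]
    · rfl
    · intro k hk
      have : k ≠ j := fun h => hj (h ▸ hk)
      simp [Pi.mulSingle_eq_of_ne this]
  refine ⟨orbitRep_isIrreducible _ _ _ ?_ ?_, ?_, ?_, ?_, fun j hj t => ⟨_, hscalar j hj t⟩, ?_⟩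
  · rintro ⟨_, a, rfl⟩ ⟨_, b, rfl⟩ hne
    by_contra! hcon
    refine hne (Subtype.ext (CharSpace.ext fun x => ?_))
    have hK : SemidirectProduct.inl (fun j => if j ∈ block i then x j else 1) ∈
        A.blockSubgroup i := fun j hj => by simp [hj]
    have hx : ∀ j ∈ block i, x j = (fun j => if j ∈ block i then x j else 1) j :=
      fun j hj => by simp [hj]
    exact (smul_blockChar_hom_congr A i e a hx).trans
      ((hcon _ hK).trans (smul_blockChar_hom_congr A i e b hx).symm)
  · rintro ⟨_, a, rfl⟩ ⟨_, b, rfl⟩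
    -- The components of b a⁻¹ outside the block may be dropped, as they stabilize the orbit
    -- pointwise.
    refine ⟨fun j => if j ∈ block i then (b * a⁻¹) j else 1, fun j hj => by simp [hj], ?_⟩
    apply Subtype.ext
    change _ • a • blockChar A i e = b • blockChar A i e
    rw [← inv_smul_eq_iff, smul_smul, smul_smul]
    refine smul_blockChar_eq_self A i e fun j hj => ?_
    simp [hj]
  · intro g hg hρ
    -- Testing on the delta function at the base point shows that `g.right` fixes that point; the
    -- constant function 1 then detects `g.left`.
    have hstab : g.right⁻¹ • (⟨_, MulAction.mem_orbit_self (blockChar A i e)⟩ :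
        MulAction.orbit (CycProd q) (blockChar A i e)) = ⟨_, MulAction.mem_orbit_self _⟩ := by
      by_contra hne
      have := congrFun (congrArg (fun f => f (Pi.single ⟨_, MulAction.mem_orbit_self _⟩ 1)) hρ)
        ⟨_, MulAction.mem_orbit_self (blockChar A i e)⟩
      rw [orbitRep_apply, Pi.single_eq_of_ne hne] at this
      simp at this
    have hright : g.right = 1 := by
      ext1 j
      by_cases hj : j ∈ block i
      · have := eq_one_of_smul_blockChar_eq_self A i e had he (congrArg Subtype.val hstab) j hj
        simpa using this
      · exact (hg j hj).2
    have hleft : g.left = 1 := by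
      have := congrFun (congrArg (fun f => f (fun _ => 1)) hρ)
        ⟨_, MulAction.mem_orbit_self (blockChar A i e)⟩
      rw [orbitRep_apply, hright, map_one, mul_one, mul_one] at this
      have h1 : ((1 : CycProd q) • blockChar A i e).hom g.left = 1 := by
        rw [one_smul]; exact Units.ext this
      ext1 j
      by_cases hj : j ∈ block i
      · exact eq_one_of_smul_blockChar_eq_one A i e had he 1 h1 j hj
      · exact (hg j hj).1
    exact SemidirectProduct.ext hleft hright
  · intro x hx hne v hv
    ext u
    have h1 := congrFun hv u
    rw [orbitRep_apply, SemidirectProduct.left_inl, SemidirectProduct.right_inl, map_one, mul_one,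
      inv_one, one_smul] at h1
    by_contra hvu
    obtain ⟨_, a, rfl⟩ := u
    have h2 := eq_one_of_smul_blockChar_eq_one A i e had he a
      (Units.ext ((mul_eq_right₀ hvu).mp h1))
    refine hne (funext fun j => ?_)
    by_cases hj : j ∈ block i
    · exact h2 j hj
    · exact hx j hj
  · intro j hj x v
    ext u
    rw [orbitRep_apply, SemidirectProduct.left_inl, SemidirectProduct.right_inl, map_one, mul_one,
      inv_one, one_smul]
    obtain ⟨_, a, rfl⟩ := u
    change (((a • blockChar A i e).hom _ : Fˣ) : F) * _ = _
    rw [smul_blockChar_hom_congr A i e a (y := 1), map_one, Units.val_one, one_mul]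
    intro k hk
    have : k ≠ j := fun h => hj (h ▸ hk)
    simp [Pi.mulSingle_eq_of_ne this]
  · intro j hj t ht v hv
    rw [hscalar j hj] at hv
    ext u
    have h1 := congrFun hv u
    rw [Pi.smul_apply, smul_eq_mul] at h1
    by_contra hvu
    exact ht (hd j ((Units.ext ((mul_eq_right₀ hvu).mp h1)).trans (map_one _).symm))

end BlockModule

/-- Since s_i − 1 is divisible by every q_j and r_j, the prime field already contains the roots of
unity needed for faithful characters. -/
theorem Admissible.nonempty_modules [∀ i, Fact (s i).Prime] (had : Admissible q r s)
    (A : QRAction q r) : Nonempty (Modules A s) := by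
  have := fun j => Fact.mk (had.prime_q j)
  choose e he using fun i j => ZMod.exists_injective_hom_units (had.r_dvd_s i j)
  choose d hd using fun i j => ZMod.exists_injective_hom_units (had.q_dvd_s i j)
  have H := fun i => isBlockModule_orbitRep A i (e i) (d i) had (he i) (hd i)
  have hfin : ∀ i, Finite (MulAction.orbit (CycProd q) (blockChar A i (e i))) :=
    fun i => Set.finite_range _
  exact ⟨{
    V := fun i => MulAction.orbit (CycProd q) (blockChar A i (e i)) → ZMod (s i)
    ρ := fun i => orbitRep (blockChar A i (e i)) (scalarChar i (d i))
    irreducible := fun i => (H i).irreducible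
    faithful := fun i => (H i).faithful
    fixedPointFree_R := fun i => (H i).fixedPointFree_R
    trivial_R := fun i => (H i).trivial_R
    scalar_Q := fun i => (H i).scalar_Q
    fixedPointFree_Q := fun i => (H i).fixedPointFree_Q }⟩

end CodegreeExample

/-! ### The order of G and its sections V_i and R_k -/

namespace CodegreeExample

variable {q r s : Fin 4 → ℕ}

instance QRAction.isSolvable_RQ (A : QRAction q r) : Group.IsSolvable A.RQ :=
  Group.isSolvable_of_ker_le_range SemidirectProduct.inl SemidirectProduct.rightHom
    SemidirectProduct.range_inl_eq_ker_rightHom.ge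

theorem QRAction.conj_inl_mulSingle (A : QRAction q r) (k : Fin 4)
    (x : Multiplicative (ZMod (r k))) (g : A.RQ) :
    g * SemidirectProduct.inl (Pi.mulSingle k x) * g⁻¹ =
      SemidirectProduct.inl (Pi.mulSingle k (A.act k g.right x)) := by
  rw [← A.piAut_mulSingle]
  refine SemidirectProduct.ext ?_ (by simp)
  simp [mul_comm]

namespace Modules

variable {A : QRAction q r} [∀ i, Fact (s i).Prime] (M : Modules A s)

instance (i : Fin 4) : Finite (M.V i) := Module.finite_of_finite (ZMod (s i))

instance (i : Fin 4) : Nontrivial (M.V i) := by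
  by_contra h
  rw [not_nontrivial_iff_subsingleton] at h
  obtain ⟨U, U', hne⟩ := (M.irreducible i).exists_pair_ne
  exact hne (Subrepresentation.toSubmodule_injective (Subsingleton.elim _ _))

theorem isSolvable : Group.IsSolvable M.G :=
  Group.isSolvable_of_ker_le_range SemidirectProduct.inl SemidirectProduct.rightHom
    SemidirectProduct.range_inl_eq_ker_rightHom.ge

/-- The prime divisors of the order of `G`, by the factor of `G` they come from. -/
def primes (q r s : Fin 4 → ℕ) : Fin 4 ⊕ (Fin 4 ⊕ Fin 4) → ℕ := Sum.elim s (Sum.elim r q)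

/-- The exponents of the primes in the order of `G`. -/
noncomputable def exponents : Fin 4 ⊕ (Fin 4 ⊕ Fin 4) → ℕ :=
  Sum.elim (fun i => finrank (ZMod (s i)) (M.V i)) fun _ => 1

theorem card_V (i : Fin 4) :
    Nat.card (Multiplicative (M.V i)) = s i ^ finrank (ZMod (s i)) (M.V i) := by
  have := Module.natCard_eq_pow_finrank (K := ZMod (s i)) (V := M.V i)
  rwa [Nat.card_zmod] at this

theorem card_G : Nat.card M.G = ∏ k, primes q r s k ^ M.exponents k := by
  rw [SemidirectProduct.card, SemidirectProduct.card, Nat.card_pi, Nat.card_pi, Nat.card_pi]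
  simp_rw [M.card_V, Nat.card_congr Multiplicative.toAdd, Nat.card_zmod]
  simp [primes, exponents, Fintype.prod_sum_type]

theorem exponents_ne_zero (k : Fin 4 ⊕ (Fin 4 ⊕ Fin 4)) : M.exponents k ≠ 0 := by
  rcases k with i | k
  · exact finrank_pos.ne'
  · exact one_ne_zero

end Modules

namespace Admissible

theorem prime_primes (h : Admissible q r s) (k) : (Modules.primes q r s k).Prime := by
  rcases k with i | i | i
  exacts [h.prime_s i, h.prime_r i, h.prime_q i]

theorem injective_primes (h : Admissible q r s) : Function.Injective (Modules.primes q r s) :=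
  h.injective_s.sumElim (h.injective_r.sumElim h.injective_q fun i j => (h.q_ne_r j i).symm) <| by
    rintro i (j | j)
    exacts [(h.r_ne_s j i).symm, (h.q_ne_s j i).symm]

end Admissible

namespace Modules

variable {A : QRAction q r} [∀ i, Fact (s i).Prime] (M : Modules A s)

theorem finite_G (had : Admissible q r s) : Finite M.G := by
  apply Nat.finite_of_card_ne_zero
  rw [M.card_G]
  exact Finset.prod_ne_zero_iff.mpr fun k _ => pow_ne_zero _ (had.prime_primes k).ne_zero

theorem primeFactors_card_G (had : Admissible q r s) :
    (Nat.card M.G).primeFactors = Finset.univ.image (primes q r s) := by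
  rw [M.card_G]
  exact Nat.primeFactors_prod_pow_eq_image had.prime_primes M.exponents_ne_zero

/-- The inclusion of `V_i` in `G`. -/
def embV (i : Fin 4) : Multiplicative (M.V i) →* M.G :=
  SemidirectProduct.inl.comp (MonoidHom.mulSingle (fun i => Multiplicative (M.V i)) i)

/-- The inclusion of `R_k` in `G`. -/
def embR (k : Fin 4) : Multiplicative (ZMod (r k)) →* M.G :=
  SemidirectProduct.inr.comp
    (SemidirectProduct.inl.comp (MonoidHom.mulSingle (fun k => Multiplicative (ZMod (r k))) k))

/-- The inclusion of `Q_j` in `G`. -/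
def embQ (j : Fin 4) : Multiplicative (ZMod (q j)) →* M.G :=
  SemidirectProduct.inr.comp
    (SemidirectProduct.inr.comp (MonoidHom.mulSingle (fun j => Multiplicative (ZMod (q j))) j))

theorem embV_injective (i : Fin 4) : Function.Injective (M.embV i) :=
  SemidirectProduct.inl_injective.comp (Pi.mulSingle_injective (M := fun i => Multiplicative (M.V i)) i)

theorem embR_injective (k : Fin 4) : Function.Injective (M.embR k) :=
  SemidirectProduct.inr_injective.comp
    (SemidirectProduct.inl_injective.comp
      (Pi.mulSingle_injective (M := fun k => Multiplicative (ZMod (r k))) k))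

theorem conj_embV (i : Fin 4) (v : Multiplicative (M.V i)) (g : M.G) :
    g * M.embV i v * g⁻¹ = M.embV i (repAut (M.ρ i) g.right v) := by
  have h := piAut_apply_mulSingle (N := fun i => Multiplicative (M.V i))
    (fun i => repAut (M.ρ i)) g.right i v
  simp only [embV, MonoidHom.comp_apply, MonoidHom.mulSingle_apply]
  rw [← h]
  refine SemidirectProduct.ext ?_ (by simp)
  simp [mul_comm]

section Irreducible

variable {W : Type*} [AddCommGroup W] [Module ℂ W]
  {ρ : Representation ℂ M.G W}

/-- A subgroup of `RQ` acting fixed point freely on a `V_i` outside the kernel has order dividing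
the degree. -/
theorem card_dvd_finrank_of_embV [FiniteDimensional ℂ W]
    (hρ : ρ.IsIrreducible) {P : Type*} [Group P] [Finite P]
    (κ : P →* A.RQ) (i : Fin 4) (hfpf : ∀ t ≠ 1, ∀ v, M.ρ i (κ t) v = v → v = 0)
    (hne : ∃ v, ρ (M.embV i v) ≠ 1) : Nat.card P ∣ finrank ℂ W := by
  refine hρ.card_dvd_finrank (M.embV i) (SemidirectProduct.inr.comp κ)
    ((repAut (M.ρ i)).comp κ) (fun t v => M.conj_embV i v _) hfpf (fun g v => ?_) hne
  have := M.conj_embV i v g⁻¹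
  rw [inv_inv] at this
  exact ⟨_, by rw [this]⟩

theorem apply_inl_eq_one {v : ∀ i, Multiplicative (M.V i)}
    (h : ∀ i, ρ (M.embV i (v i)) = 1) : ρ (SemidirectProduct.inl v) = 1 := by
  have hmem : v ∈ (MonoidHom.ker ρ).comap SemidirectProduct.inl := by
    rw [← Finset.univ_prod_mulSingle v]
    exact Subgroup.prod_mem _ fun i _ => h i
  exact hmem

/-- If `R_k` acts trivially on the `V_i` outside the kernel, then it is normal modulo the kernel. -/
theorem exists_conj_embR (k : Fin 4)
    (hk : ∀ i, k ∈ block i → ∀ v, ρ (M.embV i v) = 1) (g : M.G)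
    (x : Multiplicative (ZMod (r k))) : ∃ x', ρ (g⁻¹ * M.embR k x * g) = ρ (M.embR k x') := by
  set y : A.RQ := SemidirectProduct.inl (Pi.mulSingle k x) with hy
  -- This is the commutator of `y` with the V-part of g. Its i-th component is trivial if R_k
  -- centralizes V_i, and otherwise V_i lies in the kernel.
  have hcomm : ρ (SemidirectProduct.inl
      (g.left⁻¹ * piAut (fun i => repAut (M.ρ i)) y g.left)) = 1 := by
    refine M.apply_inl_eq_one fun i => ?_
    by_cases hi : k ∈ block i
    · exact hk i hi _
    · have : piAut (fun i => repAut (M.ρ i)) y g.left i = g.left i := M.trivial_R i k hi x _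
      rw [Pi.mul_apply, Pi.inv_apply, this, inv_mul_cancel, map_one, map_one]
  refine ⟨A.act k g.right⁻¹.right x, ?_⟩
  have h1 : M.embR k (A.act k g.right⁻¹.right x) =
      SemidirectProduct.inr (g.right⁻¹ * y * g.right) := by
    have := A.conj_inl_mulSingle k x g.right⁻¹
    rw [inv_inv] at this
    rw [hy, this]
    rfl
  have h2 : g⁻¹ * M.embR k x * g = SemidirectProduct.inr g.right⁻¹ *
      SemidirectProduct.inl (g.left⁻¹ * piAut (fun i => repAut (M.ρ i)) y g.left) *
      SemidirectProduct.inr (y * g.right) := by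
    change g⁻¹ * SemidirectProduct.inr y * g = _
    refine SemidirectProduct.ext ?_ ?_
    · simp
    · simp [mul_assoc]
  rw [h2, h1, map_mul, map_mul, hcomm, mul_one, ← map_mul, ← map_mul, mul_assoc]

theorem card_dvd_finrank_of_embR [FiniteDimensional ℂ W]
    (had : Admissible q r s) (hρ : ρ.IsIrreducible) {j k : Fin 4}
    (hjk : k ∈ actsOn j) (hk : ∀ i, k ∈ block i → ∀ v, ρ (M.embV i v) = 1)
    (hne : ∃ x, ρ (M.embR k x) ≠ 1) : q j ∣ finrank ℂ W := by
  have := Fact.mk (had.prime_q j)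
  have := Fact.mk (had.prime_r k)
  have h := hρ.card_dvd_finrank (M.embR k) (M.embQ j)
    ((A.act k).comp (MonoidHom.mulSingle (fun j => Multiplicative (ZMod (q j))) j)) (fun t x => ?_)
    (A.fixedPointFree j k hjk) (M.exists_conj_embR k hk) hne
  · rwa [Nat.card_congr Multiplicative.toAdd, Nat.card_zmod] at h
  · have h := A.conj_inl_mulSingle k x (SemidirectProduct.inr (Pi.mulSingle j t))
    have h' := congrArg (SemidirectProduct.inr : A.RQ →* M.G) h
    rwa [map_mul, map_mul, map_inv] at h'

end Irreducible

/-! ### The two bounds for σ^c(G) -/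

theorem card_primeFactors_le_four (had : Admissible q r s) {n : ℕ} (hn : n ∈ codSet M.G) :
    n.primeFactors.card ≤ 4 := by
  obtain ⟨W, _, _, _, ρ, hρ, hcod⟩ := hn
  have hfin := M.finite_G had
  have := fun j => Fact.mk (had.prime_q j)
  have := fun j => Fact.mk (had.prime_r j)
  have hW : Nontrivial W := by
    by_contra h
    rw [not_nontrivial_iff_subsingleton] at h
    obtain ⟨U, U', hne⟩ := hρ.exists_pair_ne
    exact hne (Subrepresentation.toSubmodule_injective (Subsingleton.elim _ _))
  have hmul : Nat.card (MonoidHom.ker ρ) * (n * finrank ℂ W) = Nat.card M.G := by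
    have h0 : (finrank ℂ W : ℂ) ≠ 0 := by exact_mod_cast finrank_pos.ne'
    have h1 : n * finrank ℂ W = (MonoidHom.ker ρ).index := by
      rw [codegree, Representation.char_one, div_eq_iff h0] at hcod
      exact_mod_cast hcod.symm
    rw [h1, Subgroup.card_mul_index]
  have hmax : ∀ k, ¬ primes q r s k * primes q r s k ^ M.exponents k ∣ Nat.card M.G := by
    rw [M.card_G]
    exact Nat.not_mul_pow_dvd_prod_pow had.prime_primes had.injective_primes _
  have hV : ∀ i, s i ∣ n → ∃ v, ρ (M.embV i v) ≠ 1 := by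
    intro i hi
    by_contra! hcon
    refine hmax (Sum.inl i) ?_
    -- If V_i were in the kernel, |V_i| would divide |ker ρ|, and n would contribute one factor s_i
    -- too many to |G|.
    rw [← hmul, mul_comm]
    refine mul_dvd_mul ?_ (hi.mul_right _)
    have : Nat.card (Multiplicative (M.V i)) ∣ Nat.card (MonoidHom.ker ρ) :=
      Subgroup.card_dvd_of_injective ((M.embV i).codRestrict (MonoidHom.ker ρ) hcon)
        fun a b hab => M.embV_injective i (congrArg Subtype.val hab)
    rwa [M.card_V] at this
  have hR : ∀ k, r k ∣ n → ∃ x, ρ (M.embR k x) ≠ 1 := by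
    intro k hk
    by_contra! hcon
    refine hmax (Sum.inr (Sum.inl k)) ?_
    rw [← hmul, mul_comm]
    refine mul_dvd_mul ?_ (hk.mul_right _)
    have : Nat.card (Multiplicative (ZMod (r k))) ∣ Nat.card (MonoidHom.ker ρ) :=
      Subgroup.card_dvd_of_injective ((M.embR k).codRestrict (MonoidHom.ker ρ) hcon)
        fun a b hab => M.embR_injective k (congrArg Subtype.val hab)
    rw [Nat.card_congr Multiplicative.toAdd, Nat.card_zmod] at this
    simpa [primes, exponents] using this
  -- The r_k and q_j have exponent 1 in |G|, so none divides both the codegree and the degree.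
  have hdeg : ∀ k, primes q r s (Sum.inr k) ∣ n → ¬ primes q r s (Sum.inr k) ∣ finrank ℂ W := by
    intro k hk hk'
    refine hmax (Sum.inr k) ?_
    rw [← hmul]
    exact Dvd.dvd.mul_left (mul_dvd_mul hk (by simpa [exponents] using hk')) _
  have hfpfR : ∀ i k, k ∈ block i → ∀ t : Multiplicative (ZMod (r k)), t ≠ 1 → ∀ v,
      M.ρ i (SemidirectProduct.inl.comp
        (MonoidHom.mulSingle (fun j => Multiplicative (ZMod (r j))) k) t) v = v → v = 0 := by
    intro i k hki t ht v hv
    refine M.fixedPointFree_R i (Pi.mulSingle k t) (fun j hj => ?_) (by simpa using ht) v hv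
    have : j ≠ k := fun h => hj (h ▸ hki)
    exact Pi.mulSingle_eq_of_ne this _
  have hRV : ∀ i k, k ∈ block i → r k ∣ n → ∀ v, ρ (M.embV i v) = 1 := by
    intro i k hki hk
    by_contra! hcon
    have h := M.card_dvd_finrank_of_embV hρ _ i (hfpfR i k hki) hcon
    rw [Nat.card_congr Multiplicative.toAdd, Nat.card_zmod] at h
    exact hdeg (Sum.inl k) hk h
  have hQV : ∀ i j, s i ∣ n → q j ∣ n → j ∈ block i := by
    intro i j hi hj
    by_contra hji
    refine hdeg (Sum.inr j) hj ?_
    have h := M.card_dvd_finrank_of_embV hρ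
      (SemidirectProduct.inr.comp (MonoidHom.mulSingle (fun j => Multiplicative (ZMod (q j))) j)) i
      (M.fixedPointFree_Q i j hji) (hV i hi)
    rwa [Nat.card_congr Multiplicative.toAdd, Nat.card_zmod] at h
  have hQR : ∀ j k, q j ∣ n → r k ∣ n → k ∉ actsOn j := fun j k hj hk hjk =>
    hdeg (Sum.inr j) hj (M.card_dvd_finrank_of_embR had hρ hjk (fun i hki => hRV i k hki hk)
      (hR k hk))
  have hsub : n.primeFactors ⊆
      (Finset.univ.filter fun k => primes q r s k ∣ n).image (primes q r s) := by
    intro p hp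
    have hnd : n ∣ Nat.card M.G :=
      (Dvd.intro _ rfl : n ∣ n * finrank ℂ W).trans (Dvd.intro_left _ hmul)
    have := Nat.primeFactors_mono hnd Nat.card_pos.ne' hp
    rw [M.primeFactors_card_G had, Finset.mem_image] at this
    obtain ⟨k, -, rfl⟩ := this
    exact Finset.mem_image_of_mem _ (by simpa using Nat.dvd_of_mem_primeFactors hp)
  refine (Finset.card_le_card hsub).trans (Finset.card_image_le.trans ?_)
  have hcount := card_add_card_add_card_le_four {i | s i ∣ n} {k | r k ∣ n} {j | q j ∣ n}
    (by
      simpa using fun i hi k hk hki => (hV i hi).elim fun v hv => hv (hRV i k hki hk v))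
    (by simpa using fun i hi j hj => hQV i j hi hj)
    (by simpa using fun j hj k hk => hQR j k hj hk)
  rw [Finset.card_filter, Fintype.sum_sum_type, Fintype.sum_sum_type]
  rw [Finset.card_filter, Finset.card_filter, Finset.card_filter] at hcount
  exact hcount

/-- A faithful linear character of `Q`, inflated to `G`, has the order of `Q` as its codegree. -/
theorem prod_mem_codSet (had : Admissible q r s) : ∏ j, q j ∈ codSet M.G := by
  choose f hf using fun j => Complex.exists_injective_hom_units (had.prime_q j).ne_zero
  let π : M.G →* CycProd q := SemidirectProduct.rightHom.comp SemidirectProduct.rightHom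
  have hπ : Function.Surjective π :=
    SemidirectProduct.rightHom_surjective.comp SemidirectProduct.rightHom_surjective
  have hinj : Function.Injective (prodHom f) := by
    rw [injective_iff_map_eq_one]
    intro x hx
    funext j
    have := map_mulSingle_eq_one had.coprime_q _ hx j
    rw [prodHom_mulSingle] at this
    exact hf j (this.trans (map_one _).symm)
  refine ⟨ℂ, inferInstance, inferInstance, inferInstance, scalarRep ((prodHom f).comp π), ?_, ?_⟩
  · refine { exists_pair_ne := ⟨⊥, ⊤, fun h => ?_⟩, eq_bot_or_eq_top := fun U => ?_ }
    · have h1 : (1 : ℂ) ∈ (⊥ : Subrepresentation (scalarRep ((prodHom f).comp π))) := by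
        rw [h]; trivial
      exact one_ne_zero (show (1 : ℂ) = 0 from h1)
    · exact (eq_bot_or_eq_top (show Submodule ℂ ℂ from U.toSubmodule)).imp
        (fun h => Subrepresentation.toSubmodule_injective h)
        (fun h => Subrepresentation.toSubmodule_injective h)
  · have hker : MonoidHom.ker (scalarRep ((prodHom f).comp π)) = π.ker := by
      ext g
      rw [MonoidHom.mem_ker, MonoidHom.mem_ker, ← map_eq_one_iff _ hinj]
      constructor
      · intro h
        have h1 := congrArg (fun l => l 1) h
        simp only [scalarRep_apply, mul_one, Module.End.one_apply] at h1
        exact Units.ext h1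
      · intro h
        ext
        rw [scalarRep_apply, MonoidHom.comp_apply, h]
        simp
    have hidx : π.ker.index = ∏ j, q j := by
      rw [Subgroup.index_ker, MonoidHom.range_eq_top.mpr hπ, Subgroup.card_top, Nat.card_pi]
      simp_rw [Nat.card_congr Multiplicative.toAdd, Nat.card_zmod]
    rw [codegree, hker, hidx, Representation.char_one, finrank_self]
    simp

theorem sigmaCEq_four (had : Admissible q r s) : SigmaCEq M.G 4 := by
  refine ⟨⟨_, M.prod_mem_codSet had, ?_⟩, ?_⟩
  · have h := Nat.primeFactors_prod_pow_eq_image had.prime_q (e := fun _ => 1)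
      fun _ => one_ne_zero
    simp only [pow_one] at h
    rw [h, Finset.card_image_of_injective _ had.injective_q]
    rfl
  · rintro _ ⟨n, hn, rfl⟩
    exact M.card_primeFactors_le_four had hn

end Modules

end CodegreeExample

theorem proposition2p3 :
    -- the four primes `q i` may be chosen arbitrarily, and suitable `r i`, `s i` exist
    (∀ q : Fin 4 → ℕ, (∀ i, (q i).Prime) → Function.Injective q →
      ∃ r s : Fin 4 → ℕ, CodegreeExample.Admissible q r s) ∧
    ∀ (q r s : Fin 4 → ℕ) [∀ i, Fact (s i).Prime], CodegreeExample.Admissible q r s →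
      -- the construction can be carried out
      Nonempty (CodegreeExample.QRAction q r) ∧
      ∀ A : CodegreeExample.QRAction q r,
        Nonempty (CodegreeExample.Modules A s) ∧
        -- every group so constructed has the asserted properties
        ∀ M : CodegreeExample.Modules A s,
          Finite M.G ∧ Group.IsSolvable M.G ∧ (Nat.card M.G).primeFactors.card = 12 ∧
            SigmaCEq M.G 4 := by
  refine ⟨CodegreeExample.exists_admissible, fun q r s _ had =>
    ⟨had.nonempty_qrAction, fun A => ⟨had.nonempty_modules A, fun M =>
      ⟨M.finite_G had, M.isSolvable, ?_, M.sigmaCEq_four had⟩⟩⟩⟩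
  rw [M.primeFactors_card_G had, Finset.card_image_of_injective _ had.injective_primes]
  rfl
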